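/- Let $n \le 4$ and let $\mathcal{S}^n$ be the space of real symmetric $n \times n$ matrices with the trace inner product $\langle X, Y\rangle = \operatorname{tr}(XY)$. Let $CP_n \subseteq \mathcal{S}^n$ be the cone of completely positive matrices, that is, of matrices $BB^t$ with $B$ an entrywise nonnegative (not necessarily square) matrix. A linear map $L$ on $\mathcal{S}^n$ has the $\mathcal{Z}$-property relative to $CP_n$ if $$X \in CP_n,\quad Y \in CP_n^{*},\quad \langle X, Y\rangle = 0 \ \Longrightarrow\ \langle L(X), Y\rangle \le 0,$$ where $CP_n^{*} = \{Y \in \mathcal{S}^n : \langle X, Y\rangle \ge 0 \text{ for all } X \in CP_n\}$. **Theorem.** Let $L$ be a linear map on $\mathcal{S}^n$ such that $L(CP_n) \subseteq CP_n$. Then $L$ cannot have the $\mathcal{Z}$-property relative to $CP_n$, except in the trivial case where $L$ is a nonnegative scalar multiple of the identity. In other words, $L$ has the $\mathcal{Z}$-property relative to $CP_n$ if and only if there is a real $\alpha \ge 0$ with $L(X) = \alpha X$ for all $X \in \mathcal{S}^n$. -/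

import Mathlib

/-- The space `𝒮ⁿ` of real symmetric `n × n` matrices. -/
def SymMat (n : ℕ) : Submodule ℝ (Matrix (Fin n) (Fin n) ℝ) where
  carrier := {A | A.IsSymm}
  zero_mem' := Matrix.isSymm_zero
  add_mem' hA hB := Matrix.IsSymm.add hA hB
  smul_mem' c _ hA := Matrix.IsSymm.smul hA c

/-- The trace inner product `⟨X, Y⟩ = tr (X Y)` on `𝒮ⁿ`. -/
noncomputable def traceInner (n : ℕ) : LinearMap.BilinForm ℝ (SymMat n) :=
  LinearMap.mk₂ ℝ
    (fun X Y => Matrix.trace ((X : Matrix (Fin n) (Fin n) ℝ) * (Y : Matrix (Fin n) (Fin n) ℝ)))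
    (by intros; simp [Matrix.add_mul])
    (by intros; simp)
    (by intros; simp [Matrix.mul_add])
    (by intros; simp)

/-- The trace form is symmetric. -/
theorem traceInner_comm (n : ℕ) (X Y : SymMat n) :
    traceInner n X Y = traceInner n Y X := by
  simp only [traceInner, LinearMap.mk₂_apply]
  exact Matrix.trace_mul_comm _ _

/-- The trace form is positive definite on symmetric matrices. -/
theorem traceInner_self_pos (n : ℕ) (X : SymMat n) (hX : X ≠ 0) :
    0 < traceInner n X X := by
  have hs : Matrix.conjTranspose (X : Matrix (Fin n) (Fin n) ℝ) = X := by
    rw [Matrix.conjTranspose_eq_transpose_of_trivial]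
    exact X.2
  have h0 : (0 : ℝ) ≤ Matrix.trace (Matrix.conjTranspose (X : Matrix (Fin n) (Fin n) ℝ) * (X : Matrix (Fin n) (Fin n) ℝ)) :=
    (Matrix.posSemidef_conjTranspose_mul_self _).trace_nonneg
  have h1 : Matrix.trace (Matrix.conjTranspose (X : Matrix (Fin n) (Fin n) ℝ) * (X : Matrix (Fin n) (Fin n) ℝ)) ≠ 0 := by
    rw [Ne, Matrix.trace_conjTranspose_mul_self_eq_zero_iff]
    simpa using hX
  rw [hs] at h0 h1
  exact lt_of_le_of_ne h0 (Ne.symm h1)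

/-- The set `CPₙ` of completely positive matrices: symmetric matrices `A = B Bᵗ` with `B` an
entrywise nonnegative, not necessarily square, matrix. -/
def CP (n : ℕ) : Set (SymMat n) :=
  {A | ∃ (m : ℕ) (B : Matrix (Fin n) (Fin m) ℝ),
    (∀ i j, 0 ≤ B i j) ∧ (A : Matrix (Fin n) (Fin n) ℝ) = B * B.transpose}

/-- `L` has the `𝒵`-property relative to `K`, for the inner product `p` on `V`:
`x ∈ K`, `y ∈ K*` and `⟨x, y⟩ = 0` imply `⟨L x, y⟩ ≤ 0`.
Here `PointedCone.dual p K` is `K* = {y | ∀ x ∈ K, 0 ≤ ⟨x, y⟩}`. -/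
def HasZProperty {V : Type*} [AddCommGroup V] [Module ℝ V] (p : LinearMap.BilinForm ℝ V)
    (K : Set V) (L : V →ₗ[ℝ] V) : Prop :=
  ∀ x ∈ K, ∀ y ∈ PointedCone.dual p K, p x y = 0 → p (L x) y ≤ 0

/-!
For `u ≥ 0` and `w ⊥ u`, the matrices `u uᵗ ∈ CPₙ` and `w wᵗ ∈ CPₙ*` are orthogonal, so the
`𝒵`-property gives `wᵗ L(u uᵗ) w ≤ 0`. As `L(u uᵗ)` is positive semidefinite, it vanishes on `u^⊥`
and hence is a multiple of `u uᵗ`. Thus every `u uᵗ` with `u ≥ 0` is an eigenvector of `L`. Since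
`(u + t v)(u + t v)ᵗ = u uᵗ + t (u vᵗ + v uᵗ) + t² v vᵗ`, the eigenvector equations at `t = 1, 2`
force the eigenvalues at independent `u, v ≥ 0` to agree, and `u vᵗ + v uᵗ` to share them. The
coordinate vectors provide a spanning set of such matrices.
-/

open Matrix

section LinearAlgebra

variable {K : Type*} [Field K]

theorem exists_eq_smul_vecMulVec_self_of_mulVec_eq_zero {ι : Type*} [Fintype ι]
    {A : Matrix ι ι K} (hA : A.IsSymm) {u : ι → K} (h : ∀ w, u ⬝ᵥ w = 0 → A *ᵥ w = 0) :
    ∃ c : K, A = c • vecMulVec u u := by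
  classical
  rcases eq_or_ne u 0 with rfl | hu
  · exact ⟨0, ext_of_mulVec_single fun i => by
      simp only [h _ (zero_dotProduct _), zero_smul, zero_mulVec]⟩
  obtain ⟨i, hi⟩ := Function.ne_iff.mp hu
  obtain ⟨z, hz⟩ : ∃ z, u ⬝ᵥ z = 1 := ⟨Pi.single i (u i)⁻¹, by simpa using mul_inv_cancel₀ hi⟩
  have mulVec_eq (x : ι → K) : A *ᵥ x = (u ⬝ᵥ x) • A *ᵥ z := by
    have hx : A *ᵥ (x - (u ⬝ᵥ x) • z) = 0 := h _ (by simp [dotProduct_sub, hz])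
    rwa [mulVec_sub, mulVec_smul, sub_eq_zero] at hx
  have mulVec_z : A *ᵥ z = (z ⬝ᵥ A *ᵥ z) • u := by
    refine dotProduct_eq _ _ fun x => ?_
    calc A *ᵥ z ⬝ᵥ x = z ⬝ᵥ A *ᵥ x := by
          rw [dotProduct_mulVec, ← mulVec_transpose, hA.eq]
      _ = (z ⬝ᵥ A *ᵥ z) • u ⬝ᵥ x := by
          rw [mulVec_eq x, dotProduct_smul, smul_dotProduct, smul_eq_mul, smul_eq_mul, mul_comm]
  refine ⟨z ⬝ᵥ A *ᵥ z, ext_of_mulVec_single fun j => ?_⟩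
  rw [mulVec_eq, mulVec_z, smul_mulVec, vecMulVec_mulVec, op_smul_eq_smul, smul_comm,
    ← mulVec_z]

theorem eq_and_map_eq_smul_of_linearIndependent [NeZero (2 : K)] {M : Type*} [AddCommGroup M]
    [Module K M] {L : M →ₗ[K] M} {x y z : M} (hind : LinearIndependent K ![x, y, z])
    {a b c d : K} (hx : L x = a • x) (hz : L z = b • z) (hc : L (x + y + z) = c • (x + y + z))
    (hd : L (x + (2 : K) • y + (2 ^ 2 : K) • z) = d • (x + (2 : K) • y + (2 ^ 2 : K) • z)) :
    a = b ∧ L y = a • y := by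
  have hy : L y = (c - a) • x + c • y + (c - b) • z := by
    simp only [map_add, hx, hz] at hc
    linear_combination (norm := module) hc
  have hrel : (2 * c - a - d) • x + (2 * (c - d)) • y + (2 * (c + b - 2 * d)) • z = 0 := by
    simp only [map_add, map_smul, hx, hy, hz] at hd
    linear_combination (norm := module) hd
  have hcoeff := Fintype.linearIndependent_iff.mp hind
    ![2 * c - a - d, 2 * (c - d), 2 * (c + b - 2 * d)] (by simpa [Fin.sum_univ_three] using hrel)
  have h₀ : 2 * c - a - d = 0 := hcoeff 0
  have h₁ : c - d = 0 := (mul_eq_zero.mp (hcoeff 1)).resolve_left two_ne_zero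
  have h₂ : c + b - 2 * d = 0 := (mul_eq_zero.mp (hcoeff 2)).resolve_left two_ne_zero
  obtain rfl : c = a := by linear_combination h₀ - h₁
  obtain rfl : c = b := by linear_combination 2 * h₁ - h₂
  exact ⟨rfl, by simpa using hy⟩

end LinearAlgebra

section RankOne

variable {n : ℕ}

/-- The symmetric rank-one matrix `u uᵗ`; those with `u ≥ 0` generate the cone `CP n`. -/
def rankOne (u : Fin n → ℝ) : SymMat n :=
  ⟨vecMulVec u u, transpose_vecMulVec u u⟩

/-- The symmetric matrix `u vᵗ + v uᵗ`, the polarization of the quadratic map `rankOne`. -/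
def symOuter (u v : Fin n → ℝ) : SymMat n :=
  ⟨vecMulVec u v + vecMulVec v u, IsSymm.ext fun i j => by
    simp only [Matrix.add_apply, vecMulVec_apply]; ring⟩

theorem coe_rankOne (u : Fin n → ℝ) :
    (rankOne u : Matrix (Fin n) (Fin n) ℝ) = vecMulVec u u := rfl

theorem coe_symOuter (u v : Fin n → ℝ) :
    (symOuter u v : Matrix (Fin n) (Fin n) ℝ) = vecMulVec u v + vecMulVec v u := rfl

theorem symOuter_self (u : Fin n → ℝ) : symOuter u u = (2 : ℝ) • rankOne u :=
  Subtype.ext (two_smul ℝ (vecMulVec u u)).symm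

theorem rankOne_add_smul (u v : Fin n → ℝ) (t : ℝ) :
    rankOne (u + t • v) = rankOne u + t • symOuter u v + t ^ 2 • rankOne v := by
  ext i j
  simp only [coe_rankOne, coe_symOuter, vecMulVec_apply, Pi.add_apply, Pi.smul_apply, smul_eq_mul,
    Submodule.coe_add, Submodule.coe_smul, Matrix.add_apply, Matrix.smul_apply]
  ring

theorem linearIndependent_rankOne_symOuter_rankOne {u v : Fin n → ℝ}
    (h : LinearIndependent ℝ ![u, v]) :
    LinearIndependent ℝ ![rankOne u, symOuter u v, rankOne v] := by
  rw [Fintype.linearIndependent_iff]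
  intro g hg
  have hcol (j : Fin n) :
      (g 0 * u j + g 1 * v j) • u + (g 1 * u j + g 2 * v j) • v = 0 := by
    ext i
    have hij := congrFun₂ (congrArg Subtype.val hg) i j
    simp only [Fin.sum_univ_three, cons_val_zero, cons_val_one, cons_val, Submodule.coe_add,
      Submodule.coe_smul, Submodule.coe_zero, coe_rankOne, coe_symOuter, Matrix.add_apply,
      Matrix.smul_apply, Matrix.zero_apply, vecMulVec_apply, smul_eq_mul] at hij
    simp only [Pi.add_apply, Pi.smul_apply, Pi.zero_apply, smul_eq_mul]
    linear_combination hij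
  have hcoeff (j : Fin n) := LinearIndependent.pair_iff.mp h _ _ (hcol j)
  have h₀₁ := LinearIndependent.pair_iff.mp h (g 0) (g 1) (funext fun j => (hcoeff j).1)
  have h₁₂ := LinearIndependent.pair_iff.mp h (g 1) (g 2) (funext fun j => (hcoeff j).2)
  exact Fin.forall_fin_succ.mpr ⟨h₀₁.1, Fin.forall_fin_two.mpr h₁₂⟩

theorem eq_sum_smul_symOuter_single (X : SymMat n) :
    X = ∑ i, ∑ j, ((X : Matrix (Fin n) (Fin n) ℝ) i j / 2) •
      symOuter (Pi.single i 1) (Pi.single j 1) := by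
  ext k l
  have hlk : (X : Matrix (Fin n) (Fin n) ℝ) l k = (X : Matrix (Fin n) (Fin n) ℝ) k l :=
    X.2.apply k l
  simp [coe_symOuter, vecMulVec_apply, Matrix.sum_apply, Pi.single_apply,
    Finset.sum_add_distrib, hlk]

theorem eq_and_map_symOuter_eq_smul {L : SymMat n →ₗ[ℝ] SymMat n} {c : (Fin n → ℝ) → ℝ}
    (hc : ∀ u, 0 ≤ u → L (rankOne u) = c u • rankOne u) {u v : Fin n → ℝ} (hu : 0 ≤ u)
    (hv : 0 ≤ v) (huv : LinearIndependent ℝ ![u, v]) :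
    c u = c v ∧ L (symOuter u v) = c u • symOuter u v := by
  have hadd {t : ℝ} (ht : 0 ≤ t) := hc (u + t • v) (add_nonneg hu (smul_nonneg ht hv))
  simp only [rankOne_add_smul] at hadd
  exact eq_and_map_eq_smul_of_linearIndependent (linearIndependent_rankOne_symOuter_rankOne huv)
    (hc u hu) (hc v hv) (by simpa using hadd zero_le_one) (hadd zero_le_two)

theorem exists_forall_eq_smul_of_map_rankOne {L : SymMat n →ₗ[ℝ] SymMat n}
    (h : ∀ u : Fin n → ℝ, 0 ≤ u → ∃ c : ℝ, L (rankOne u) = c • rankOne u) :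
    ∃ α : ℝ, ∀ X, L X = α • X := by
  rcases isEmpty_or_nonempty (Fin n) with _ | ⟨⟨i₀⟩⟩
  · exact ⟨0, fun X => Subtype.ext (Subsingleton.elim _ _)⟩
  choose! c hc using h
  let e (i : Fin n) : Fin n → ℝ := Pi.single i 1
  have he (i : Fin n) : 0 ≤ e i := Pi.single_nonneg.mpr zero_le_one
  have hpair {i j : Fin n} (hij : i ≠ j) :
      c (e i) = c (e j) ∧ L (symOuter (e i) (e j)) = c (e i) • symOuter (e i) (e j) := by
    refine eq_and_map_symOuter_eq_smul hc (he i) (he j) (LinearIndependent.pair_iff.mpr ?_)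
    intro s t hst
    exact ⟨by simpa [e, hij] using congrFun hst i, by simpa [e, hij.symm] using congrFun hst j⟩
  have hconst (i : Fin n) : c (e i) = c (e i₀) := by
    rcases eq_or_ne i i₀ with rfl | hi
    · rfl
    · exact (hpair hi).1
  have hsymOuter (i j : Fin n) :
      L (symOuter (e i) (e j)) = c (e i₀) • symOuter (e i) (e j) := by
    rcases eq_or_ne i j with rfl | hij
    · rw [symOuter_self, map_smul, hc _ (he i), hconst, smul_comm]
    · rw [(hpair hij).2, hconst]
  refine ⟨c (e i₀), fun X => ?_⟩
  rw [eq_sum_smul_symOuter_single X]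
  simp only [map_sum, map_smul, hsymOuter, Finset.smul_sum, smul_comm (c (e i₀)), e]

end RankOne

section ZProperty

variable {n : ℕ} {K : Set (SymMat n)}

theorem rankOne_mem_CP {u : Fin n → ℝ} (hu : 0 ≤ u) : rankOne u ∈ CP n :=
  ⟨1, Matrix.of fun i _ => u i, fun i _ => hu i, by
    ext; simp [coe_rankOne, vecMulVec_apply, mul_apply]⟩

theorem posSemidef_of_mem_CP {X : SymMat n} (hX : X ∈ CP n) :
    (X : Matrix (Fin n) (Fin n) ℝ).PosSemidef := by
  obtain ⟨m, B, -, hB⟩ := hX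
  simpa [hB] using posSemidef_self_mul_conjTranspose B

theorem traceInner_rankOne (X : SymMat n) (w : Fin n → ℝ) :
    traceInner n X (rankOne w) = w ⬝ᵥ (X : Matrix (Fin n) (Fin n) ℝ) *ᵥ w := by
  simp [traceInner, coe_rankOne, mul_vecMulVec, dotProduct_comm]

theorem rankOne_mem_dual (hK : ∀ X ∈ K, (X : Matrix (Fin n) (Fin n) ℝ).PosSemidef)
    (w : Fin n → ℝ) : rankOne w ∈ PointedCone.dual (traceInner n) K :=
  PointedCone.mem_dual.mpr fun X hX => by
    simpa [traceInner_rankOne] using (hK X hX).dotProduct_mulVec_nonneg w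

theorem HasZProperty.exists_map_rankOne_eq_smul {L : SymMat n →ₗ[ℝ] SymMat n}
    (hZ : HasZProperty (traceInner n) K L)
    (hK : ∀ X ∈ K, (X : Matrix (Fin n) (Fin n) ℝ).PosSemidef) {u : Fin n → ℝ}
    (hu : rankOne u ∈ K) (hLu : (L (rankOne u) : Matrix (Fin n) (Fin n) ℝ).PosSemidef) :
    ∃ c : ℝ, L (rankOne u) = c • rankOne u := by
  obtain ⟨c, hc⟩ := exists_eq_smul_vecMulVec_self_of_mulVec_eq_zero (L (rankOne u)).2
    (u := u) fun w huw => by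
    have horth : traceInner n (rankOne u) (rankOne w) = 0 := by
      simp [traceInner_rankOne, coe_rankOne, vecMulVec_mulVec, huw]
    have hle := hZ _ hu _ (rankOne_mem_dual hK w) horth
    rw [traceInner_rankOne] at hle
    exact (hLu.dotProduct_mulVec_zero_iff w).mp (hle.antisymm (hLu.dotProduct_mulVec_nonneg w))
  exact ⟨c, Subtype.ext hc⟩

end ZProperty

theorem mainTheorem5_general {n : ℕ} {K : Set (SymMat n)} (hCP : CP n ⊆ K)
    (hK : ∀ X ∈ K, (X : Matrix (Fin n) (Fin n) ℝ).PosSemidef) (L : SymMat n →ₗ[ℝ] SymMat n)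
    (hL : ∀ X ∈ CP n, (L X : Matrix (Fin n) (Fin n) ℝ).PosSemidef) :
    HasZProperty (traceInner n) K L ↔ ∃ α : ℝ, 0 ≤ α ∧ ∀ X : SymMat n, L X = α • X := by
  constructor
  · intro hZ
    obtain ⟨α, hα⟩ := exists_forall_eq_smul_of_map_rankOne fun u hu =>
      have hmem := rankOne_mem_CP hu
      hZ.exists_map_rankOne_eq_smul hK (hCP hmem) (hL _ hmem)
    rcases isEmpty_or_nonempty (Fin n) with _ | ⟨⟨i⟩⟩
    · exact ⟨0, le_rfl, fun X => Subtype.ext (Subsingleton.elim _ _)⟩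
    · have he : (0 : Fin n → ℝ) ≤ Pi.single i 1 := Pi.single_nonneg.mpr zero_le_one
      have hdiag := (hL _ (rankOne_mem_CP he)).diag_nonneg (i := i)
      exact ⟨α, by simpa [hα, coe_rankOne, vecMulVec_apply] using hdiag, hα⟩
  · rintro ⟨α, -, hα⟩ X - Y - hXY
    rw [hα, map_smul, LinearMap.smul_apply, hXY, smul_zero]

theorem mainTheorem5 (n : ℕ) (hn : n ≤ 4) (L : SymMat n →ₗ[ℝ] SymMat n)
    (hL : ∀ X ∈ CP n, L X ∈ CP n) :
    HasZProperty (traceInner n) (CP n) L ↔ ∃ α : ℝ, 0 ≤ α ∧ ∀ X : SymMat n, L X = α • X :=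
  mainTheorem5_general subset_rfl (fun _ => posSemidef_of_mem_CP) L fun X hX =>
    posSemidef_of_mem_CP (hL X hX)
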